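/- Let $K$ be a field, $n\ge 2$, and let $S=K[p_{ij}:1\le i<j\le n]$ be the polynomial ring in $\binom n2$ variables. Let $I_{L_n}\subset S$ be the Plücker ideal, i.e. the kernel of the $K$-algebra homomorphism $S\to K[x_1,\dots,x_n,y_1,\dots,y_n]$, $p_{ij}\mapsto x_iy_j-x_jy_i$. Let $G$ be a simple graph on the vertex set $[n]=\{1,\dots,n\}$, and suppose that for some $1\le j<k\le n$ the complement $G^c$ is isomorphic to the graph on $[n]$ whose edges are $$\{1,2\},\{1,3\},\dots,\{1,n\},\{2,3\},\dots,\{j,j+1\},\dots,\{j,k\},$$ that is, all $\{a,b\}$ with $a<b$ such that $(a,b)$ is lexicographically at most $(j,k)$. Then the elimination ideal $$I_G=I_{L_n}\cap K[p_{ij}:\{i,j\}\in E(G)]$$ is generated, as an ideal of $K[p_{ij}:\{i,j\}\in E(G)]$, by the quadratic Plücker relations $$p_{ab}p_{cd}-p_{ac}p_{bd}+p_{ad}p_{bc},\qquad 1\le a<b<c<d\le n,$$ for which all six pairs $\{a,b\},\{c,d\},\{a,c\},\{b,d\},\{a,d\},\{b,c\}$ are edges of $G$. -/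

import Mathlib

open MvPolynomial

/-- Index set of the Plücker variables `p_{ij}`, `i < j`. The vertices `1, …, n` are modelled by
`Fin n` with its usual order. -/
abbrev PluckerIndex (n : ℕ) : Type := {e : Fin n × Fin n // e.1 < e.2}

/-- The polynomial ring `S = K[p_{ij} : i < j]`. -/
abbrev PluckerRing (K : Type*) [Field K] (n : ℕ) : Type _ := MvPolynomial (PluckerIndex n) K

/-- The Plücker variable `p_{ij}`, for `i < j`. -/
noncomputable def pluckerVar (K : Type*) [Field K] {n : ℕ} {i j : Fin n} (h : i < j) :
    PluckerRing K n :=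
  X ⟨(i, j), h⟩

/-- The `K`-algebra map `p_{ij} ↦ x_i y_j - x_j y_i` from `S` to
`K[x_1, …, x_n, y_1, …, y_n]`; here `x_i = X (Sum.inl i)` and `y_i = X (Sum.inr i)`. -/
noncomputable def pluckerMap (K : Type*) [Field K] (n : ℕ) :
    PluckerRing K n →ₐ[K] MvPolynomial (Fin n ⊕ Fin n) K :=
  aeval fun e : PluckerIndex n =>
    X (Sum.inl e.1.1) * X (Sum.inr e.1.2) - X (Sum.inl e.1.2) * X (Sum.inr e.1.1)

/-- The Plücker ideal: the defining ideal of the algebra generated by the `x_i y_j - x_j y_i`. -/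
noncomputable def pluckerIdeal (K : Type*) [Field K] (n : ℕ) : Ideal (PluckerRing K n) :=
  RingHom.ker (pluckerMap K n)

/-- The quadratic Plücker relation `p_{ij} p_{kl} - p_{ik} p_{jl} + p_{il} p_{jk}`,
for `i < j < k < l`. -/
noncomputable def pluckerRelation (K : Type*) [Field K] {n : ℕ} {i j k l : Fin n}
    (hij : i < j) (hjk : j < k) (hkl : k < l) : PluckerRing K n :=
  pluckerVar K hij * pluckerVar K hkl
    - pluckerVar K (hij.trans hjk) * pluckerVar K (hjk.trans hkl)
    + pluckerVar K (hij.trans (hjk.trans hkl)) * pluckerVar K hjk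

/-- The subring `K[p_{ij} : {i,j} ∈ E(G)]` of `S`. -/
noncomputable abbrev edgeRing (K : Type*) [Field K] {n : ℕ} (G : SimpleGraph (Fin n)) :
    Subalgebra K (PluckerRing K n) :=
  supported K {e : PluckerIndex n | G.Adj e.1.1 e.1.2}

/-- The elimination ideal `I_G = I ∩ K[p_{ij} : {i,j} ∈ E(G)]` of the Plücker ideal `I`, as an
ideal of `K[p_{ij} : {i,j} ∈ E(G)]`. -/
noncomputable def eliminationIdeal (K : Type*) [Field K] {n : ℕ} (G : SimpleGraph (Fin n)) :
    Ideal (edgeRing K G) :=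
  (pluckerIdeal K n).comap (edgeRing K G).val

/-- The quadratic Plücker relations all of whose six variables are edges of `G`, as elements of
`K[p_{ij} : {i,j} ∈ E(G)]`. -/
def edgePluckerRelations (K : Type*) [Field K] {n : ℕ} (G : SimpleGraph (Fin n)) :
    Set (edgeRing K G) :=
  {f | ∃ (i j k l : Fin n) (hij : i < j) (hjk : j < k) (hkl : k < l),
    G.Adj i j ∧ G.Adj k l ∧ G.Adj i k ∧ G.Adj j l ∧ G.Adj i l ∧ G.Adj j k ∧
      (f : PluckerRing K n) = pluckerRelation K hij hjk hkl}

/-- The graph whose edges are the `{a,b}`, `a < b`, with `(a,b)` lexicographically at most `(j,k)`: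
`{1,2}, {1,3}, …, {1,n}, {2,3}, …, {j,j+1}, …, {j,k}`. -/
def lexSegmentGraph {n : ℕ} (j k : Fin n) : SimpleGraph (Fin n) :=
  SimpleGraph.fromRel fun a b => a < b ∧ toLex (a, b) ≤ toLex (j, k)

/-- `G` is compatible with the elimination order `p_{12} > p_{13} > ⋯ > p_{1n} > p_{23} > ⋯`. -/
def CompatibleWithEliminationOrder {n : ℕ} (G : SimpleGraph (Fin n)) : Prop :=
  ∃ j k : Fin n, j < k ∧ Nonempty (Gᶜ ≃g lexSegmentGraph j k)

/-! The argument is a SAGBI lifting. After relabelling, `G` is a clique on the vertices above `j`,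
with `j` joined to those above `k` and all smaller vertices isolated. Direct every edge towards the
larger value of an injective `ρ` and give `y_i` weight `ρ i`: the minor of an edge from `s` to `t`
has initial term `x_s y_t`. The relations among these initial terms are the binomials of a bipartite
graph. `exchange_connected` reduces them to exchanges of the targets of two edges, `exchange_lifts`
lifts each exchange to a Plücker relation of `G` whose remaining term has smaller weight, and
`ker_edgeMinorMap_le` concludes by descent on the weight.

The choice of `ρ` is decisive. In the labelling order, an exchange between `j` and a source in `(j,
k]` would need a Plücker relation using a non-edge. Moving the block `(j, k]` to the top makes the
neighbours of `j` an initial segment of the targets; a source that shares two targets with `j` is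
then adjacent to `j`. Relabelling is harmless because Plücker relations are alternating. -/

/-! ### Initial forms and lifting of toric relations -/

section InitialForms

open Finsupp

variable {K : Type*} [Field K] {V D : Type*} (s t : D → V) (ρ : V → ℕ)

/-- The bidegree of a monomial in edge variables: the exponent of `∏ x_{s d} y_{t d}`. -/
noncomputable def edgeDegree : (D →₀ ℕ) →+ (V ⊕ V →₀ ℕ) :=
  (linearCombination ℕ fun d => single (Sum.inl (s d)) 1 + single (Sum.inr (t d)) 1).toAddMonoidHom

/-- The weight for which `x_i` has weight `0` and `y_j` has weight `ρ j`. -/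
noncomputable def xyWeight : (V ⊕ V →₀ ℕ) →+ ℕ :=
  (linearCombination ℕ (Sum.elim (fun _ => 0) ρ)).toAddMonoidHom

/-- The weight of the initial form of the image of a monomial in edge variables. -/
noncomputable def edgeWeight : (D →₀ ℕ) →+ ℕ := (xyWeight ρ).comp (edgeDegree s t)

variable (K) in
/-- The algebra map `p_d ↦ x_{s d} y_{t d} - x_{t d} y_{s d}`. -/
noncomputable def edgeMinorMap : MvPolynomial D K →ₐ[K] MvPolynomial (V ⊕ V) K :=
  aeval fun d => X (Sum.inl (s d)) * X (Sum.inr (t d)) - X (Sum.inl (t d)) * X (Sum.inr (s d))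

variable (K) in
/-- The polynomials all of whose monomials have weight less than `N`. -/
noncomputable def weightLT (N : ℕ) : Submodule K (MvPolynomial D K) :=
  Submodule.span K ((fun w => monomial w 1) '' {w | edgeWeight s t ρ w < N})

variable (K) in
/-- The initial form of weight `N`, each monomial replaced by its bidegree. -/
noncomputable def initialForm (N : ℕ) : MvPolynomial D K →ₗ[K] MvPolynomial (V ⊕ V) K :=
  open Classical in (basisMonomials D K).constr K fun w =>
    if edgeWeight s t ρ w = N then monomial (edgeDegree s t w) 1 else 0

variable (K) in
/-- A linear map sending a bidegree to some monomial of that bidegree. -/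
noncomputable def edgeSection : MvPolynomial (V ⊕ V) K →ₗ[K] MvPolynomial D K :=
  (basisMonomials (V ⊕ V) K).constr K fun m =>
    monomial (Function.invFun (edgeDegree s t) m) 1

@[simp]
lemma edgeDegree_single (d : D) :
    edgeDegree s t (single d 1) = single (Sum.inl (s d)) 1 + single (Sum.inr (t d)) 1 := by
  simp [edgeDegree]

@[simp]
lemma xyWeight_single_inl (i : V) (k : ℕ) : xyWeight ρ (single (Sum.inl i) k) = 0 := by
  simp [xyWeight]

@[simp]
lemma xyWeight_single_inr (i : V) (k : ℕ) : xyWeight ρ (single (Sum.inr i) k) = k * ρ i := by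
  simp [xyWeight]

@[simp]
lemma edgeWeight_single (d : D) : edgeWeight s t ρ (single d 1) = ρ (t d) := by
  simp [edgeWeight]

lemma edgeWeight_congr {w w' : D →₀ ℕ} (h : edgeDegree s t w = edgeDegree s t w') :
    edgeWeight s t ρ w = edgeWeight s t ρ w' := by
  simp [edgeWeight, h]

lemma initialForm_monomial (N : ℕ) (w : D →₀ ℕ) [Decidable (edgeWeight s t ρ w = N)] :
    initialForm K s t ρ N (monomial w 1) =
      if edgeWeight s t ρ w = N then monomial (edgeDegree s t w) 1 else 0 := by
  have := (basisMonomials D K).constr_basis K (fun w =>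
    open Classical in
    if edgeWeight s t ρ w = N then monomial (edgeDegree s t w) (1 : K) else 0) w
  rw [coe_basisMonomials] at this
  rw [initialForm, this]
  congr

lemma edgeSection_monomial (m : V ⊕ V →₀ ℕ) :
    edgeSection K s t (monomial m 1) = monomial (Function.invFun (edgeDegree s t) m) 1 := by
  have := (basisMonomials (V ⊕ V) K).constr_basis K (fun m =>
    monomial (Function.invFun (edgeDegree s t) m) (1 : K)) m
  rwa [coe_basisMonomials] at this

variable {s t ρ}

lemma monomial_mem_weightLT {N : ℕ} {w : D →₀ ℕ} (h : edgeWeight s t ρ w < N) :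
    monomial w (1 : K) ∈ weightLT K s t ρ N :=
  Submodule.subset_span ⟨w, h, rfl⟩

lemma mem_weightLT_of_forall {N : ℕ} {f : MvPolynomial D K}
    (h : ∀ w ∈ f.support, edgeWeight s t ρ w < N) : f ∈ weightLT K s t ρ N := by
  rw [f.as_sum]
  refine Submodule.sum_mem _ fun w hw => ?_
  have := Submodule.smul_mem _ (f.coeff w) (monomial_mem_weightLT (K := K) (h w hw))
  simpa [smul_monomial] using this

lemma monomial_mul_mem_weightLT {N : ℕ} (u : D →₀ ℕ) {f : MvPolynomial D K}
    (hf : f ∈ weightLT K s t ρ N) :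
    monomial u 1 * f ∈ weightLT K s t ρ (edgeWeight s t ρ u + N) := by
  induction hf using Submodule.span_induction with
  | mem x hx =>
    obtain ⟨w, hw, rfl⟩ := hx
    simp only [Set.mem_ofPred_eq] at hw
    simp only [monomial_mul, mul_one]
    exact monomial_mem_weightLT (by simpa using hw)
  | zero => simp
  | add x y _ _ hx hy => rw [mul_add]; exact add_mem hx hy
  | smul c x _ hx => rw [mul_smul_comm]; exact Submodule.smul_mem _ _ hx

lemma exists_add_single {w : D →₀ ℕ} {d : D} (h : w d ≠ 0) : ∃ u, w = u + single d 1 :=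
  ⟨w - single d 1, (sub_add_single_one_cancel h).symm⟩

lemma induction_add_single {P : (D →₀ ℕ) → Prop} (zero : P 0)
    (add_single : ∀ w d, P w → P (w + single d 1)) (w : D →₀ ℕ) : P w := by
  induction h : w.degree generalizing w with
  | zero => rwa [(degree_eq_zero_iff w).1 h]
  | succ k ih =>
    obtain ⟨d, hd⟩ : ∃ d, w d ≠ 0 := by
      by_contra! hw
      obtain rfl : w = 0 := Finsupp.ext hw
      simp at h
    obtain ⟨u, rfl⟩ := exists_add_single hd
    exact add_single u d (ih u (by simpa using h))

/-- In each factor `x_s y_t - x_t y_s` the second term has strictly smaller weight, so only the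
product of the first terms reaches the top weight. -/
lemma coeff_edgeMinorMap_monomial (hρ : ∀ d, ρ (s d) < ρ (t d)) (w : D →₀ ℕ)
    (m : V ⊕ V →₀ ℕ) (h : edgeWeight s t ρ w ≤ xyWeight ρ m) :
    coeff m (edgeMinorMap K s t (monomial w 1)) =
      coeff m (monomial (edgeDegree s t w) (1 : K)) := by
  classical
  induction w using induction_add_single generalizing m with
  | zero => simp
  | add_single w d ih =>
    have hd := hρ d
    simp only [map_add, edgeWeight_single] at h
    have hmul : monomial (w + single d 1) (1 : K) = monomial w 1 * X d := by
      rw [X, monomial_mul, mul_one]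
    have hX : edgeMinorMap K s t (X d) =
        monomial (single (Sum.inl (s d)) 1 + single (Sum.inr (t d)) 1) 1 -
          monomial (single (Sum.inl (t d)) 1 + single (Sum.inr (s d)) 1) 1 := by
      rw [edgeMinorMap, aeval_X]
      simp [X, monomial_mul]
    rw [hmul, map_mul, hX, mul_sub, coeff_sub, coeff_mul_monomial', coeff_mul_monomial', map_add,
      edgeDegree_single]
    -- Here `m'` outweighs `w` strictly, so by induction its coefficient is that of a monomial of
    -- smaller weight, namely zero.
    have second : (if single (Sum.inl (t d)) 1 + single (Sum.inr (s d)) 1 ≤ m then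
        coeff (m - (single (Sum.inl (t d)) 1 + single (Sum.inr (s d)) 1))
          (edgeMinorMap K s t (monomial w 1)) * 1 else 0) = 0 := by
      split_ifs with hle
      · obtain ⟨m', rfl⟩ := exists_add_of_le hle
        simp only [map_add, xyWeight_single_inl, xyWeight_single_inr] at h
        rw [add_tsub_cancel_left, mul_one, ih _ (by omega), coeff_monomial, if_neg]
        rintro rfl
        have : edgeWeight s t ρ w = xyWeight ρ (edgeDegree s t w) := rfl
        omega
      · rfl
    rw [second, sub_zero]
    split_ifs with hle
    · obtain ⟨m', rfl⟩ := exists_add_of_le hle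
      simp only [map_add, xyWeight_single_inl, xyWeight_single_inr] at h
      rw [add_tsub_cancel_left, mul_one, ih _ (by omega), coeff_monomial, coeff_monomial]
      congr 1
      rw [add_comm, add_right_inj]
    · rw [coeff_monomial, if_neg]
      rintro rfl
      exact hle le_add_self

lemma coeff_initialForm (hρ : ∀ d, ρ (s d) < ρ (t d)) {N : ℕ} {f : MvPolynomial D K}
    (hf : f ∈ weightLT K s t ρ (N + 1)) {m : V ⊕ V →₀ ℕ} (hm : xyWeight ρ m = N) :
    coeff m (initialForm K s t ρ N f) = coeff m (edgeMinorMap K s t f) := by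
  classical
  induction hf using Submodule.span_induction with
  | mem x hx =>
    obtain ⟨w, hw, rfl⟩ := hx
    simp only [Set.mem_ofPred_eq] at hw
    rw [coeff_edgeMinorMap_monomial hρ w m (by omega), initialForm_monomial]
    split_ifs with h
    · rfl
    · rw [coeff_zero, coeff_monomial, if_neg]
      rintro rfl
      exact h hm
  | zero => simp
  | add x y _ _ hx hy => simp [hx, hy]
  | smul c x _ hx => simp [hx]

lemma coeff_initialForm_of_ne (N : ℕ) (f : MvPolynomial D K) {m : V ⊕ V →₀ ℕ}
    (hm : xyWeight ρ m ≠ N) : coeff m (initialForm K s t ρ N f) = 0 := by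
  classical
  induction f using MvPolynomial.induction_on' with
  | monomial w a =>
    rw [← mul_one a, ← smul_eq_mul, ← smul_monomial, map_smul, initialForm_monomial]
    split_ifs with h
    · rw [coeff_smul, coeff_monomial, if_neg, smul_zero]
      rintro rfl
      exact hm h
    · simp
  | add p q hp hq => simp [hp, hq]

lemma initialForm_eq_zero (hρ : ∀ d, ρ (s d) < ρ (t d)) {N : ℕ} {f : MvPolynomial D K}
    (hf : f ∈ weightLT K s t ρ (N + 1)) (hf0 : edgeMinorMap K s t f = 0) :
    initialForm K s t ρ N f = 0 := by
  ext m
  by_cases hm : xyWeight ρ m = N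
  · rw [coeff_initialForm hρ hf hm, hf0]
  · rw [coeff_initialForm_of_ne N f hm, coeff_zero]

/-- If the exchanges of targets between two edges lift to `J` up to terms of smaller weight, then
monomials connected by exchanges agree modulo `J` and terms of smaller weight. -/
lemma monomial_sub_monomial_mem {J : Ideal (MvPolynomial D K)}
    (lift : ∀ d₁ d₂ e₁ e₂ : D, s e₁ = s d₁ → t e₁ = t d₂ → s e₂ = s d₂ → t e₂ = t d₁ →
      s d₁ ≠ s d₂ → t d₁ ≠ t d₂ → ∃ (a b : D) (c : K), ρ (t a) + ρ (t b) < ρ (t d₁) + ρ (t d₂) ∧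
        X d₁ * X d₂ - X e₁ * X e₂ - C c * (X a * X b) ∈ J)
    (hinj : ∀ d e : D, s d = s e → t d = t e → d = e)
    (conn : ∀ w w' : D →₀ ℕ, edgeDegree s t w = edgeDegree s t w' → w ≠ 0 →
      (∃ d, w d ≠ 0 ∧ w' d ≠ 0) ∨
      (∃ d₁ d₂ e₁ e₂ : D, w d₁ ≠ 0 ∧ w d₂ ≠ 0 ∧ w' e₁ ≠ 0 ∧ s e₁ = s d₁ ∧ t e₁ = t d₂ ∧
        s e₂ = s d₂ ∧ t e₂ = t d₁) ∨
      (∃ d₁ d₂ e₁ e₂ : D, w' d₁ ≠ 0 ∧ w' d₂ ≠ 0 ∧ w e₁ ≠ 0 ∧ s e₁ = s d₁ ∧ t e₁ = t d₂ ∧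
        s e₂ = s d₂ ∧ t e₂ = t d₁))
    (w w' : D →₀ ℕ) (h : edgeDegree s t w = edgeDegree s t w') :
    monomial w (1 : K) - monomial w' 1 ∈
      J.restrictScalars K ⊔ weightLT K s t ρ (edgeWeight s t ρ w) := by
  have mul_mem (u : D →₀ ℕ) (N : ℕ) (f : MvPolynomial D K)
      (hf : f ∈ J.restrictScalars K ⊔ weightLT K s t ρ N) :
      monomial u 1 * f ∈ J.restrictScalars K ⊔ weightLT K s t ρ (edgeWeight s t ρ u + N) := by
    obtain ⟨g, hg, l, hl, rfl⟩ := Submodule.mem_sup.1 hf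
    rw [mul_add]
    exact Submodule.add_mem_sup (J.mul_mem_left _ hg) (monomial_mul_mem_weightLT u hl)
  have degree_eq (w : D →₀ ℕ) : (edgeDegree s t w).degree = 2 * w.degree := by
    induction w using induction_add_single with
    | zero => simp
    | add_single w d ih => simp [ih]; ring
  induction hk : w.degree generalizing w w' with
  | zero =>
    have h' := congrArg Finsupp.degree h
    rw [degree_eq, degree_eq, hk] at h'
    rw [(degree_eq_zero_iff w).1 hk, (degree_eq_zero_iff w').1 (by omega), sub_self]
    exact zero_mem _
  | succ k ih =>
    have common (w w' : D →₀ ℕ) (h : edgeDegree s t w = edgeDegree s t w') (hk : w.degree = k + 1)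
        (d : D) (hd : w d ≠ 0) (hd' : w' d ≠ 0) : monomial w (1 : K) - monomial w' 1 ∈
          J.restrictScalars K ⊔ weightLT K s t ρ (edgeWeight s t ρ w) := by
      obtain ⟨u, rfl⟩ := exists_add_single hd
      obtain ⟨u', rfl⟩ := exists_add_single hd'
      have := mul_mem (single d 1) _ _ (ih u u' (by simpa using h) (by simpa using hk))
      rwa [mul_sub, monomial_mul, monomial_mul, mul_one, ← map_add, add_comm _ u,
        add_comm _ u'] at this
    have exchange (w w' : D →₀ ℕ) (h : edgeDegree s t w = edgeDegree s t w')
        (hk : w.degree = k + 1) (d₁ d₂ e₁ e₂ : D) (h₁ : w d₁ ≠ 0) (h₂ : w d₂ ≠ 0) (h' : w' e₁ ≠ 0)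
        (hs₁ : s e₁ = s d₁) (ht₁ : t e₁ = t d₂) (hs₂ : s e₂ = s d₂) (ht₂ : t e₂ = t d₁) :
        monomial w (1 : K) - monomial w' 1 ∈
          J.restrictScalars K ⊔ weightLT K s t ρ (edgeWeight s t ρ w) := by
      -- In the degenerate exchanges `e₁` is `d₂` or `d₁`, already an edge common to both monomials.
      by_cases hs : s d₁ = s d₂
      · exact common w w' h hk d₂ h₂ (hinj e₁ d₂ (hs₁.trans hs) ht₁ ▸ h')
      by_cases ht : t d₁ = t d₂
      · exact common w w' h hk d₁ h₁ (hinj e₁ d₁ hs₁ (ht₁.trans ht.symm) ▸ h')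
      obtain ⟨v, rfl⟩ := exists_add_single h₂
      have hne : d₁ ≠ d₂ := fun h => hs (congrArg s h)
      have hv : v d₁ ≠ 0 := by simpa [hne.symm] using h₁
      obtain ⟨u, rfl⟩ := exists_add_single hv
      have hdeg : edgeDegree s t (u + single d₁ 1 + single d₂ 1) =
          edgeDegree s t (u + single e₂ 1 + single e₁ 1) := by
        simp only [map_add, edgeDegree_single, hs₁, hs₂, ht₁, ht₂]
        abel
      have hstep : monomial (u + single d₁ 1 + single d₂ 1) (1 : K) -
          monomial (u + single e₂ 1 + single e₁ 1) 1 ∈ J.restrictScalars K ⊔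
            weightLT K s t ρ (edgeWeight s t ρ (u + single d₁ 1 + single d₂ 1)) := by
        obtain ⟨a, b, c, hlt, hJ⟩ := lift d₁ d₂ e₁ e₂ hs₁ ht₁ hs₂ ht₂ hs ht
        have hmem : X d₁ * X d₂ - X e₁ * X e₂ ∈
            J.restrictScalars K ⊔ weightLT K s t ρ (ρ (t d₁) + ρ (t d₂)) := by
          rw [← sub_add_cancel (X d₁ * X d₂ - X e₁ * X e₂) (C c * (X a * X b))]
          refine Submodule.add_mem_sup hJ ?_
          rw [X, X, monomial_mul, mul_one, ← smul_eq_C_mul]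
          exact Submodule.smul_mem _ _ (monomial_mem_weightLT (by simpa using hlt))
        have := mul_mem u _ _ hmem
        simp only [map_add, edgeWeight_single, add_assoc]
        convert this using 1
        simp only [X, mul_sub, monomial_mul, mul_one]
        rw [add_comm (single e₁ 1)]
      -- After the exchange both monomials contain `e₁`, which can be cancelled.
      rw [← sub_add_sub_cancel]
      refine add_mem hstep ?_
      rw [edgeWeight_congr s t ρ hdeg]
      exact common _ w' (hdeg ▸ h) (by simpa using hk) e₁ (by simp) h'
    have hw : w ≠ 0 := by
      rintro rfl
      simp at hk
    have hk' : w'.degree = k + 1 := by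
      have h' := congrArg Finsupp.degree h
      rw [degree_eq, degree_eq] at h'
      omega
    rcases conn w w' h hw with ⟨d, hd, hd'⟩ | ⟨d₁, d₂, e₁, e₂, h₁, h₂, h', r⟩ |
      ⟨d₁, d₂, e₁, e₂, h₁, h₂, h', r⟩
    · exact common w w' h hk d hd hd'
    · exact exchange w w' h hk d₁ d₂ e₁ e₂ h₁ h₂ h' r.1 r.2.1 r.2.2.1 r.2.2.2
    · rw [edgeWeight_congr s t ρ h, ← neg_sub]
      exact neg_mem (exchange w' w h.symm hk' d₁ d₂ e₁ e₂ h₁ h₂ h' r.1 r.2.1 r.2.2.1 r.2.2.2)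

/-- If the toric relations of the initial algebra lift to `J`, then `J` contains every relation
between the minors. -/
lemma ker_edgeMinorMap_le (hρ : ∀ d, ρ (s d) < ρ (t d)) {J : Ideal (MvPolynomial D K)}
    (hJ : J ≤ RingHom.ker (edgeMinorMap K s t))
    (toric : ∀ w w' : D →₀ ℕ, edgeDegree s t w = edgeDegree s t w' →
      monomial w (1 : K) - monomial w' 1 ∈
        J.restrictScalars K ⊔ weightLT K s t ρ (edgeWeight s t ρ w)) :
    RingHom.ker (edgeMinorMap K s t) ≤ J := by
  have key (N : ℕ) : ∀ f ∈ weightLT K s t ρ N, edgeMinorMap K s t f = 0 → f ∈ J := by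
    induction N with
    | zero =>
      intro f hf _
      simp only [weightLT, not_lt_zero, Set.ofPred_false, Set.image_empty, Submodule.span_empty,
        Submodule.mem_bot] at hf
      exact hf ▸ J.zero_mem
    | succ N ih =>
      intro f hf hf0
      -- Modulo `J` and smaller weight, a monomial of weight `N` depends only on its bidegree. As
      -- the initial form of a relation vanishes, this places `f` itself in `J` up to smaller
      -- weight.
      have reduce : f - edgeSection K s t (initialForm K s t ρ N f) ∈
          J.restrictScalars K ⊔ weightLT K s t ρ N := by
        classical
        clear hf0
        induction hf using Submodule.span_induction with
        | mem x hx =>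
          obtain ⟨w, hw, rfl⟩ := hx
          simp only [Set.mem_ofPred_eq] at hw
          rw [initialForm_monomial]
          split_ifs with h
          · rw [edgeSection_monomial, ← h]
            exact toric _ _ (Function.invFun_eq ⟨w, rfl⟩).symm
          · rw [map_zero, sub_zero]
            exact Submodule.mem_sup_right (monomial_mem_weightLT (by omega))
        | zero => simp
        | add x y _ _ hx hy =>
          rw [map_add, map_add, add_sub_add_comm]
          exact add_mem hx hy
        | smul c x _ hx =>
          rw [map_smul, map_smul, ← smul_sub]
          exact Submodule.smul_mem _ _ hx
      rw [initialForm_eq_zero hρ hf hf0, map_zero, sub_zero] at reduce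
      obtain ⟨g, hg, l, hl, rfl⟩ := Submodule.mem_sup.1 reduce
      have hg0 : edgeMinorMap K s t g = 0 := hJ hg
      rw [map_add, hg0, zero_add] at hf0
      exact J.add_mem hg (ih l hl hf0)
  intro f hf
  refine key (f.support.sup (edgeWeight s t ρ) + 1) f (mem_weightLT_of_forall fun w hw => ?_) hf
  exact Nat.lt_succ_of_le (Finset.le_sup (f := edgeWeight s t ρ) hw)

end InitialForms

/-! ### Alternating Plücker variables and relations -/

section SignedVariables

variable (K : Type*) [Field K] {n : ℕ}

/-- The Plücker variable `p_{ij}` for arbitrary `i`, `j`, alternating in its indices. -/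
noncomputable def signedVar (i j : Fin n) : PluckerRing K n :=
  if h : i < j then pluckerVar K h else if h : j < i then -pluckerVar K h else 0

/-- The quadratic Plücker relation for arbitrary indices. -/
noncomputable def signedRelation (a b c d : Fin n) : PluckerRing K n :=
  signedVar K a b * signedVar K c d - signedVar K a c * signedVar K b d +
    signedVar K a d * signedVar K b c

variable {K}

lemma signedVar_of_lt {i j : Fin n} (h : i < j) : signedVar K i j = pluckerVar K h := dif_pos h

lemma signedVar_swap (i j : Fin n) : signedVar K i j = -signedVar K j i := by
  rcases lt_trichotomy i j with h | rfl | h 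
  · simp [signedVar, h, h.not_gt]
  · simp [signedVar]
  · simp [signedVar, h, h.not_gt]

lemma pluckerMap_signedVar (i j : Fin n) :
    pluckerMap K n (signedVar K i j) =
      X (Sum.inl i) * X (Sum.inr j) - X (Sum.inl j) * X (Sum.inr i) := by
  rcases lt_trichotomy i j with h | rfl | h
  · simp [signedVar, h, pluckerMap, pluckerVar]
  · simp [signedVar]
  · simp [signedVar, h, h.not_gt, pluckerMap, pluckerVar]

lemma signedRelation_of_lt {a b c d : Fin n} (hab : a < b) (hbc : b < c) (hcd : c < d) :
    signedRelation K a b c d = pluckerRelation K hab hbc hcd := by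
  simp only [signedRelation, pluckerRelation, signedVar_of_lt hab, signedVar_of_lt hbc,
    signedVar_of_lt hcd, signedVar_of_lt (hab.trans hbc), signedVar_of_lt (hbc.trans hcd),
    signedVar_of_lt (hab.trans (hbc.trans hcd))]

lemma signedRelation_swap₁₂ (a b c d : Fin n) :
    signedRelation K a b c d = -signedRelation K b a c d := by
  simp only [signedRelation, signedVar_swap b a]
  ring

lemma signedRelation_swap₂₃ (a b c d : Fin n) :
    signedRelation K a b c d = -signedRelation K a c b d := by
  simp only [signedRelation, signedVar_swap c b]
  ring

lemma signedRelation_swap₃₄ (a b c d : Fin n) :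
    signedRelation K a b c d = -signedRelation K a b d c := by
  simp only [signedRelation, signedVar_swap d c]
  ring

lemma pluckerMap_signedRelation (a b c d : Fin n) :
    pluckerMap K n (signedRelation K a b c d) = 0 := by
  simp only [signedRelation, map_add, map_sub, map_mul, pluckerMap_signedVar]
  ring

variable (G : SimpleGraph (Fin n))

variable {G} in
lemma signedVar_mem_edgeRing {i j : Fin n} (h : G.Adj i j) : signedVar K i j ∈ edgeRing K G := by
  rcases lt_or_gt_of_ne h.ne with hij | hij
  · rw [signedVar_of_lt hij]
    exact Algebra.subset_adjoin ⟨_, h, rfl⟩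
  · rw [signedVar_swap, signedVar_of_lt hij]
    exact neg_mem (Algebra.subset_adjoin ⟨_, h.symm, rfl⟩)

/-- The signed Plücker variable of an edge as an element of the edge ring. -/
noncomputable def edgeVar {i j : Fin n} (h : G.Adj i j) : edgeRing K G :=
  ⟨signedVar K i j, signedVar_mem_edgeRing h⟩

variable (K) in
/-- The relation on `a, b, c, d` lies in the ideal generated by the Plücker relations of `G`. -/
def RelationMem (a b c d : Fin n) : Prop :=
  ∃ f ∈ Ideal.span (edgePluckerRelations K G), (f : PluckerRing K n) = signedRelation K a b c d

variable {G}

lemma RelationMem.of_eq_neg {a b c d a' b' c' d' : Fin n}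
    (h : signedRelation K a' b' c' d' = -signedRelation K a b c d) (H : RelationMem K G a b c d) :
    RelationMem K G a' b' c' d' := by
  obtain ⟨f, hf, hfe⟩ := H
  exact ⟨-f, neg_mem hf, by rw [h, ← hfe]; rfl⟩

lemma relationMem_of_lt {a b c d : Fin n} (hab : a < b) (hbc : b < c) (hcd : c < d)
    (h : G.IsClique {a, b, c, d}) : RelationMem K G a b c d := by
  have adj {i j : Fin n} (hi : i ∈ ({a, b, c, d} : Set (Fin n))) (hj : j ∈ ({a, b, c, d} : Set _))
      (hij : i < j) : G.Adj i j := h hi hj hij.ne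
  have h₁ := adj (by simp) (by simp) hab
  have h₂ := adj (by simp) (by simp) hcd
  have h₃ := adj (by simp) (by simp) (hab.trans hbc)
  have h₄ := adj (by simp) (by simp) (hbc.trans hcd)
  have h₅ := adj (by simp) (by simp) (hab.trans (hbc.trans hcd))
  have h₆ := adj (by simp) (by simp) hbc
  let f : edgeRing K G := edgeVar G h₁ * edgeVar G h₂ - edgeVar G h₃ * edgeVar G h₄ +
    edgeVar G h₅ * edgeVar G h₆
  have hf : (f : PluckerRing K n) = signedRelation K a b c d := rfl
  exact ⟨f, Ideal.subset_span ⟨a, b, c, d, hab, hbc, hcd, h₁, h₂, h₃, h₄, h₅, h₆,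
    hf.trans (signedRelation_of_lt hab hbc hcd)⟩, hf⟩

lemma relationMem_of_lt_of_lt {a b c d : Fin n} (hab : a < b) (hbc : b < c)
    (had : a ≠ d) (hbd : b ≠ d) (hcd : c ≠ d) (h : G.IsClique {a, b, c, d}) :
    RelationMem K G a b c d := by
  rcases lt_or_gt_of_ne hcd with hcd | hcd
  · exact relationMem_of_lt hab hbc hcd h
  refine .of_eq_neg (signedRelation_swap₃₄ a b c d) ?_
  rcases lt_or_gt_of_ne hbd with hbd | hbd
  · exact relationMem_of_lt hab hbd hcd (h.subset (by grind))
  refine .of_eq_neg (signedRelation_swap₂₃ a b d c) ?_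
  rcases lt_or_gt_of_ne had with had | had
  · exact relationMem_of_lt had hbd hbc (h.subset (by grind))
  refine .of_eq_neg (signedRelation_swap₁₂ a d b c) ?_
  exact relationMem_of_lt had hab hbc (h.subset (by grind))

lemma relationMem_of_first_lt {a b c d : Fin n} (hab : a < b) (hac : a ≠ c) (hbc : b ≠ c)
    (had : a ≠ d) (hbd : b ≠ d) (hcd : c ≠ d) (h : G.IsClique {a, b, c, d}) :
    RelationMem K G a b c d := by
  rcases lt_or_gt_of_ne hbc with hbc | hbc
  · exact relationMem_of_lt_of_lt hab hbc had hbd hcd h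
  refine .of_eq_neg (signedRelation_swap₂₃ a b c d) ?_
  rcases lt_or_gt_of_ne hac with hac | hac
  · exact relationMem_of_lt_of_lt hac hbc had hcd hbd (h.subset (by grind))
  refine .of_eq_neg (signedRelation_swap₁₂ a c b d) ?_
  exact relationMem_of_lt_of_lt hac hab hcd had hbd (h.subset (by grind))

/-- Adjacent transpositions only change the sign of the relation, so the four indices can be sorted
by insertion. -/
lemma relationMem {a b c d : Fin n} (hab : G.Adj a b) (hac : G.Adj a c) (had : G.Adj a d)
    (hbc : G.Adj b c) (hbd : G.Adj b d) (hcd : G.Adj c d) : RelationMem K G a b c d := by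
  have h : G.IsClique {a, b, c, d} := by
    simp [SimpleGraph.isClique_insert, hab, hac, had, hbc, hbd, hcd]
  rcases lt_or_gt_of_ne hab.ne with hlt | hlt
  · exact relationMem_of_first_lt hlt hac.ne hbc.ne had.ne hbd.ne hcd.ne h
  refine .of_eq_neg (signedRelation_swap₁₂ a b c d) ?_
  exact relationMem_of_first_lt hlt hbc.ne hac.ne hbd.ne had.ne hcd.ne (h.subset (by grind))

lemma span_edgePluckerRelations_le :
    Ideal.span (edgePluckerRelations K G) ≤ eliminationIdeal K G := by
  rw [Ideal.span_le]
  rintro f ⟨a, b, c, d, hab, hbc, hcd, -, -, -, -, -, -, hf⟩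
  change pluckerMap K n (f : PluckerRing K n) = 0
  rw [hf, ← signedRelation_of_lt, pluckerMap_signedRelation]

end SignedVariables

/-! ### Presentation of the edge ring by directed edges -/

section Orientation

variable {K : Type*} [Field K] {n : ℕ} (G : SimpleGraph (Fin n)) (ρ : Fin n → ℕ)

/-- The edges of `G`, directed towards the larger value of `ρ`. -/
abbrev DirectedEdge : Type := {d : Fin n × Fin n // G.Adj d.1 d.2 ∧ ρ d.1 < ρ d.2}

variable (K) in
/-- The presentation of the edge ring by the directed edges. -/
noncomputable def orientationMap : MvPolynomial (DirectedEdge G ρ) K →ₐ[K] edgeRing K G :=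
  aeval fun d => edgeVar G d.2.1

variable {ρ}

lemma pluckerMap_orientationMap (f : MvPolynomial (DirectedEdge G ρ) K) :
    pluckerMap K n (orientationMap K G ρ f) =
      edgeMinorMap K (fun d : DirectedEdge G ρ => d.1.1) (fun d => d.1.2) f := by
  have : ((pluckerMap K n).comp (edgeRing K G).val).comp (orientationMap K G ρ) =
      edgeMinorMap K (fun d : DirectedEdge G ρ => d.1.1) (fun d => d.1.2) := by
    ext1 d
    simp only [AlgHom.comp_apply, orientationMap, edgeMinorMap, aeval_X]
    exact pluckerMap_signedVar _ _
  exact DFunLike.congr_fun this f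

variable {G}

lemma exists_orientationMap_eq_edgeVar (hρ : Function.Injective ρ) {i j : Fin n} (h : G.Adj i j) :
    ∃ (d : DirectedEdge G ρ) (c : K), ρ d.1.2 = max (ρ i) (ρ j) ∧
      orientationMap K G ρ (C c * X d) = edgeVar G h := by
  rcases lt_or_gt_of_ne (hρ.ne h.ne) with hij | hij
  · refine ⟨⟨(i, j), h, hij⟩, 1, (max_eq_right hij.le).symm, ?_⟩
    simp [orientationMap]
  · refine ⟨⟨(j, i), h.symm, hij⟩, -1, (max_eq_left hij.le).symm, ?_⟩
    simp only [orientationMap, map_neg, map_one, neg_mul, one_mul, aeval_X]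
    exact Subtype.ext (signedVar_swap i j).symm

lemma orientationMap_surjective (hρ : Function.Injective ρ) :
    Function.Surjective (orientationMap K G ρ) := by
  rintro ⟨f, hf⟩
  have hle : edgeRing K G ≤ ((edgeRing K G).val.comp (orientationMap K G ρ)).range := by
    refine Algebra.adjoin_le ?_
    rintro _ ⟨⟨⟨i, j⟩, hij⟩, h, rfl⟩
    obtain ⟨d, c, -, hd⟩ := exists_orientationMap_eq_edgeVar (K := K) hρ h
    exact ⟨C c * X d, (congrArg Subtype.val hd).trans (signedVar_of_lt hij)⟩
  obtain ⟨g, hg⟩ := hle hf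
  exact ⟨g, Subtype.ext hg⟩

/-- With sources `i, j` and targets `k, l`, the third term of the Plücker relation is `p_ij p_kl`.
Its weight is smaller because both sources lie below both targets. -/
lemma exchange_lifts (hρ : Function.Injective ρ) (d₁ d₂ e₁ e₂ : DirectedEdge G ρ)
    (hs₁ : e₁.1.1 = d₁.1.1) (ht₁ : e₁.1.2 = d₂.1.2) (hs₂ : e₂.1.1 = d₂.1.1)
    (ht₂ : e₂.1.2 = d₁.1.2) (hs : G.Adj d₁.1.1 d₂.1.1) (ht : G.Adj d₁.1.2 d₂.1.2) :
    ∃ (a b : DirectedEdge G ρ) (c : K), ρ a.1.2 + ρ b.1.2 < ρ d₁.1.2 + ρ d₂.1.2 ∧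
      X d₁ * X d₂ - X e₁ * X e₂ - C c * (X a * X b) ∈
        (Ideal.span (edgePluckerRelations K G)).comap (orientationMap K G ρ) := by
  obtain ⟨⟨_, _⟩, hik, hik'⟩ := d₁
  obtain ⟨⟨_, _⟩, hjl, hjl'⟩ := d₂
  obtain ⟨⟨i, l⟩, hil, hil'⟩ := e₁
  obtain ⟨⟨j, k⟩, hjk, hjk'⟩ := e₂
  dsimp only at *
  subst hs₁ ht₁ hs₂ ht₂
  obtain ⟨a, c, ha, ha'⟩ := exists_orientationMap_eq_edgeVar (K := K) hρ hs
  obtain ⟨b, c', hb, hb'⟩ := exists_orientationMap_eq_edgeVar (K := K) hρ ht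
  refine ⟨a, b, c * c', ?_, ?_⟩
  · have := hρ.ne hs.ne
    have := hρ.ne ht.ne
    have : ρ i < ρ k := hik'
    have : ρ j < ρ l := hjl'
    have : ρ i < ρ l := hil'
    have : ρ j < ρ k := hjk'
    rw [ha, hb]
    omega
  · obtain ⟨f, hf, hfe⟩ := relationMem (K := K) hs hik hil hjk hjl ht
    rw [Ideal.mem_comap, C_mul, mul_mul_mul_comm, map_sub, map_mul _ (C c * X a), ha', hb']
    convert neg_mem hf
    refine Subtype.ext ?_
    simp only [orientationMap, map_sub, map_mul, aeval_X]
    change signedVar K _ _ * signedVar K _ _ - signedVar K _ _ * signedVar K _ _ -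
      signedVar K _ _ * signedVar K _ _ = -(f : PluckerRing K n)
    rw [hfe, signedRelation]
    ring

end Orientation

/-! ### Connectivity of monomials of equal bidegree -/

section Connectivity

variable {V D : Type*} {s t : D → V} {ρ : V → ℕ}

lemma edgeDegree_ne_zero {w : D →₀ ℕ} {d : D} (h : w d ≠ 0) :
    edgeDegree s t w (Sum.inl (s d)) ≠ 0 ∧ edgeDegree s t w (Sum.inr (t d)) ≠ 0 := by
  obtain ⟨u, rfl⟩ := exists_add_single h
  simp

lemma exists_of_edgeDegree_inl_ne_zero {w : D →₀ ℕ} {i : V}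
    (h : edgeDegree s t w (Sum.inl i) ≠ 0) : ∃ d, w d ≠ 0 ∧ s d = i := by
  induction w using induction_add_single with
  | zero => simp at h
  | add_single w d ih =>
    by_cases hd : s d = i
    · exact ⟨d, by simp, hd⟩
    · obtain ⟨e, he, hs⟩ := ih (by simpa [hd] using h)
      exact ⟨e, by simp [he], hs⟩

lemma exists_of_edgeDegree_inr_ne_zero {w : D →₀ ℕ} {j : V}
    (h : edgeDegree s t w (Sum.inr j) ≠ 0) : ∃ d, w d ≠ 0 ∧ t d = j := by
  induction w using induction_add_single with
  | zero => simp at h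
  | add_single w d ih =>
    by_cases hd : t d = j
    · exact ⟨d, by simp, hd⟩
    · obtain ⟨e, he, hs⟩ := ih (by simpa [hd] using h)
      exact ⟨e, by simp [he], hs⟩

lemma exists_same_source {w w' : D →₀ ℕ} (h : edgeDegree s t w = edgeDegree s t w') {d : D}
    (hd : w d ≠ 0) : ∃ e, w' e ≠ 0 ∧ s e = s d :=
  exists_of_edgeDegree_inl_ne_zero (h ▸ (edgeDegree_ne_zero hd).1)

lemma exists_same_target {w w' : D →₀ ℕ} (h : edgeDegree s t w = edgeDegree s t w') {d : D}
    (hd : w d ≠ 0) : ∃ e, w' e ≠ 0 ∧ t e = t d :=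
  exists_of_edgeDegree_inr_ne_zero (h ▸ (edgeDegree_ne_zero hd).2)

/-- Connectivity by exchanges for a bipartite graph on sources and targets in which the
neighbourhoods of the sources other than `v` are nested final segments, and that of `v` is an
initial segment of the targets. -/
lemma exchange_connected (v : V) (hinj : ∀ d e : D, s d = s e → t d = t e → d = e)
    (final : ∀ d e : D, s d ≠ v → ρ (s d) < ρ (t e) → t e ≠ v → ∃ f, s f = s d ∧ t f = t e)
    (initial : ∀ d e : D, s d = v → ρ (t e) ≤ ρ (t d) → ∃ f, s f = v ∧ t f = t e)
    (hρ : ∀ d, ρ (s d) < ρ (t d)) (hv : ∀ d, t d ≠ v)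
    (w w' : D →₀ ℕ) (h : edgeDegree s t w = edgeDegree s t w') (hw : w ≠ 0) :
    (∃ d, w d ≠ 0 ∧ w' d ≠ 0) ∨
    (∃ d₁ d₂ e₁ e₂ : D, w d₁ ≠ 0 ∧ w d₂ ≠ 0 ∧ w' e₁ ≠ 0 ∧ s e₁ = s d₁ ∧ t e₁ = t d₂ ∧
      s e₂ = s d₂ ∧ t e₂ = t d₁) ∨
    (∃ d₁ d₂ e₁ e₂ : D, w' d₁ ≠ 0 ∧ w' d₂ ≠ 0 ∧ w e₁ ≠ 0 ∧ s e₁ = s d₁ ∧ t e₁ = t d₂ ∧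
      s e₂ = s d₂ ∧ t e₂ = t d₁) := by
  classical
  -- If `v` is the only source, an edge is determined by its target, so `w` and `w'` share an edge.
  by_cases hall : ∀ d, w d ≠ 0 → s d = v
  · obtain ⟨d, hd⟩ := Finsupp.ne_iff.1 hw
    obtain ⟨e, he, hte⟩ := exists_same_target h hd
    obtain ⟨f, hf, hsf⟩ := exists_same_source h.symm he
    exact .inl ⟨d, hd, hinj d e ((hall d hd).trans ((hall f hf).symm.trans hsf)) hte.symm ▸ he⟩
  push Not at hall
  -- Maximality of `s d` among the sources other than `v` puts all of these below the targets `t d`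
  -- and `t d'`, where `final` applies.
  obtain ⟨d, hd, hmax⟩ := (w.support.filter (s · ≠ v)).exists_max_image (fun d => ρ (s d))
    (by obtain ⟨d, hd⟩ := hall; exact ⟨d, by simpa using hd⟩)
  simp only [Finset.mem_filter, Finsupp.mem_support_iff] at hd hmax
  obtain ⟨hd, hdv⟩ := hd
  have hmax' (r : D) (hr : w' r ≠ 0) (hrv : s r ≠ v) : ρ (s r) ≤ ρ (s d) := by
    obtain ⟨f, hf, hsf⟩ := exists_same_source h.symm hr
    rw [← hsf] at hrv ⊢
    exact hmax f ⟨hf, hrv⟩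
  obtain ⟨d', hd', hsd⟩ := exists_same_source h hd
  obtain ⟨r, hr, htr⟩ := exists_same_target h.symm hd'
  by_cases hrt : ∃ e, s e = s r ∧ t e = t d
  · obtain ⟨e, hse, hte⟩ := hrt
    exact .inr (.inl ⟨d, r, d', e, hd, hr, hd', hsd, htr.symm, hse, hte⟩)
  have hrv : s r = v := by
    by_contra hrv
    exact hrt (final r d hrv ((hmax r ⟨hr, hrv⟩).trans_lt (hρ d)) (hv d))
  have hlt : ρ (t d') < ρ (t d) := by
    by_contra! hle
    obtain ⟨f, hf⟩ := initial r d hrv (htr ▸ hle)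
    exact hrt ⟨f, hf.1.trans hrv.symm, hf.2⟩
  -- Now `t d` is not a neighbour of `v`, so the edge of `w'` ending there has another source, and
  -- exchanging it with `d'` produces `d`.
  obtain ⟨r', hr', htr'⟩ := exists_same_target h hd
  have hrv' : s r' ≠ v := fun hv' => hrt ⟨r', hv'.trans hrv.symm, htr'⟩
  obtain ⟨e, hse, hte⟩ := final r' d' hrv'
    ((hmax' r' hr' hrv').trans_lt (hsd ▸ hρ d')) (hv d')
  exact .inr (.inr ⟨d', r', d, e, hd', hr', hd, hsd.symm, htr'.symm, hse, hte⟩)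

end Connectivity

/-! ### Complements of lexicographic segments -/

lemma lexSegmentGraph_adj_of_lt {n : ℕ} {j k a b : Fin n} (h : a < b) :
    (lexSegmentGraph j k).Adj a b ↔ a < j ∨ a = j ∧ b ≤ k := by
  simp [lexSegmentGraph, Prod.Lex.toLex_le_toLex, h, h.ne, h.not_gt]

theorem mainTheorem9 {K : Type*} [Field K] {n : ℕ} (G : SimpleGraph (Fin n))
    (hG : CompatibleWithEliminationOrder G) :
    eliminationIdeal K G = Ideal.span (edgePluckerRelations K G) := by
  obtain ⟨j, k, hjk, ⟨e⟩⟩ := hG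
  have adj_iff {a b : Fin n} (h : e a < e b) :
      G.Adj a b ↔ j < e a ∨ e a = j ∧ k < e b := by
    have hab : a ≠ b := fun h' => h.ne (congrArg e h')
    have := (e.map_adj_iff (v := a) (w := b)).symm.trans (lexSegmentGraph_adj_of_lt h)
    rw [SimpleGraph.compl_adj] at this
    simp only [hab, ne_eq, not_false_eq_true, true_and] at this
    rw [← not_iff_not, this]
    omega
  -- Adding `n` lifts the non-neighbours of `j` in the clique above every other vertex.
  let ρ : Fin n → ℕ := fun a => if j < e a ∧ e a ≤ k then e a + n else e a
  have hρ : Function.Injective ρ := by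
    intro a b hab
    refine e.injective (Fin.ext ?_)
    simp only [ρ] at hab
    split_ifs at hab <;> omega
  have adj (a b : Fin n) :
      G.Adj a b ↔ e a ≠ e b ∧ (j < e a ∧ j < e b ∨ e a = j ∧ k < e b ∨ e b = j ∧ k < e a) := by
    rcases lt_trichotomy (e a) (e b) with h | h | h
    · rw [adj_iff h]
      omega
    · simp [e.injective h]
    · rw [G.adj_comm, adj_iff h]
      omega
  have directed (a b : Fin n) : (G.Adj a b ∧ ρ a < ρ b) ↔
      ρ a < ρ b ∧ j < e b ∧ (j < e a ∨ e a = j ∧ k < e b) := by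
    rw [adj]
    simp only [ρ]
    split_ifs <;> omega
  have lift (d₁ d₂ e₁ e₂ : DirectedEdge G ρ)
      (hs₁ : e₁.1.1 = d₁.1.1) (ht₁ : e₁.1.2 = d₂.1.2) (hs₂ : e₂.1.1 = d₂.1.1)
      (ht₂ : e₂.1.2 = d₁.1.2) (hs : d₁.1.1 ≠ d₂.1.1) (ht : d₁.1.2 ≠ d₂.1.2) :
      G.Adj d₁.1.1 d₂.1.1 ∧ G.Adj d₁.1.2 d₂.1.2 := by
    have h₁ := (directed _ _).1 d₁.2
    have h₂ := (directed _ _).1 d₂.2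
    have h₃ := (directed _ _).1 e₁.2
    have h₄ := (directed _ _).1 e₂.2
    rw [hs₁, ht₁] at h₃
    rw [hs₂, ht₂] at h₄
    have hs' := e.injective.ne hs
    have ht' := e.injective.ne ht
    rw [adj, adj]
    refine ⟨⟨hs', ?_⟩, ht', .inl ⟨h₁.2.1, h₂.2.1⟩⟩
    -- If one source is `j`, both targets lie above `k` and keep their labels; the other source lies
    -- below them in `ρ`, hence outside the lifted block, and is adjacent to `j`.
    simp only [ρ] at h₁ h₂ h₃ h₄
    split_ifs at h₁ h₂ h₃ h₄ <;> omega
  have hinj (d f : DirectedEdge G ρ) (hs : d.1.1 = f.1.1) (ht : d.1.2 = f.1.2) : d = f :=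
    Subtype.ext (Prod.ext hs ht)
  have conn := exchange_connected (s := fun d : DirectedEdge G ρ => d.1.1) (t := fun d => d.1.2)
    (ρ := ρ) (e.symm j) hinj
    (fun d f hd hlt hf => by
      have h₁ := (directed _ _).1 d.2
      have h₂ := (directed _ _).1 f.2
      have hd' : e d.1.1 ≠ j := fun h => hd (e.injective (h.trans (e.apply_symm_apply j).symm))
      have hlt' : j < e d.1.1 := by omega
      exact ⟨⟨(d.1.1, f.1.2), (directed _ _).2 ⟨hlt, h₂.2.1, .inl hlt'⟩⟩, rfl, rfl⟩)
    (fun d f hd hle => by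
      have h₁ := (directed _ _).1 d.2
      have h₂ := (directed _ _).1 f.2
      have hd' : e d.1.1 = j := by rw [hd, e.apply_symm_apply]
      refine ⟨⟨(d.1.1, f.1.2), (directed _ _).2 ?_⟩, hd, rfl⟩
      simp only [ρ] at hle h₁ h₂ ⊢
      split_ifs at hle h₁ h₂ ⊢ <;> omega)
    (fun d => d.2.2)
    (fun d hd => by
      have h₁ := ((directed _ _).1 d.2).2.1
      rw [hd, e.apply_symm_apply] at h₁
      exact h₁.false)
  refine le_antisymm (fun f hf => ?_) span_edgePluckerRelations_le
  obtain ⟨g, rfl⟩ := orientationMap_surjective hρ f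
  refine ker_edgeMinorMap_le (ρ := ρ) (fun d => d.2.2)
    (J := (Ideal.span (edgePluckerRelations K G)).comap (orientationMap K G ρ)) (fun f hf => ?_)
    (monomial_sub_monomial_mem (fun d₁ d₂ e₁ e₂ hs₁ ht₁ hs₂ ht₂ hs ht => ?_) hinj conn)
    ((pluckerMap_orientationMap G g).symm.trans hf)
  · exact (pluckerMap_orientationMap G f).symm.trans (span_edgePluckerRelations_le hf)
  · obtain ⟨hs', ht'⟩ := lift d₁ d₂ e₁ e₂ hs₁ ht₁ hs₂ ht₂ hs ht
    exact exchange_lifts hρ d₁ d₂ e₁ e₂ hs₁ ht₁ hs₂ ht₂ hs' ht'
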